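/- For a finite simple graph $G$ and $k\ge 0$, a $k$-sparse $j$-set of $G$ is a set of $j$ vertices each of which has at most $k$ neighbours inside the set; a $k$-dense $i$-set of $G$ is a set of $i$ vertices that is $k$-sparse in the complement of $G$, i.e. each of its vertices is non-adjacent to at most $k$ other vertices of the set. Let $R_k^{\mathcal{BIP}}(i,j)$ denote the smallest $n$ such that every bipartite graph on $n$ vertices has a $k$-dense $i$-set or a $k$-sparse $j$-set. **Theorem.** $R_1^{\mathcal{BIP}}(4,10)=18$. That is, every bipartite graph on $18$ vertices has a $1$-dense $4$-set or a $1$-sparse $10$-set, and for every $n<18$ there is a bipartite graph on $n$ vertices that has neither. In particular $R_1^{\mathcal{BIP}}(4,10)\neq 2\cdot 10-1=19$, so the conjectured equality $R_1^{\mathcal{BIP}}(4,j)=2j-1$ fails for $j=10$. -/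

import Mathlib

universe u

/-- `S` is a `k`-sparse set of `G`: each vertex of `S` has at most `k` neighbours in `S`. -/
def IsSparseSet {V : Type u} (G : SimpleGraph V) (k : ℕ) (S : Finset V) : Prop :=
  ∀ v ∈ S, {w : V | w ∈ S ∧ G.Adj v w}.ncard ≤ k

/-- `D` is a `k`-dense set of `G`: it is `k`-sparse in the complement of `G`, that is,
each vertex of `D` is non-adjacent to at most `k` other vertices of `D`. -/
def IsDenseSet {V : Type u} (G : SimpleGraph V) (k : ℕ) (D : Finset V) : Prop :=
  IsSparseSet Gᶜ k D

/-- A class of graphs, given by its membership predicate. -/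
abbrev GraphClass : Type (u + 1) := ∀ V : Type u, SimpleGraph V → Prop

/-- The class of bipartite graphs. -/
def bipartiteGraphs : GraphClass.{u} := fun _ G => G.IsBipartite

/-- Every graph on exactly `n` vertices in the class `C` has a `k`-dense `i`-set or a
`k`-sparse `j`-set. -/
def DefectiveRamseyProperty (C : GraphClass.{u}) (k i j n : ℕ) : Prop :=
  ∀ (V : Type u) [Fintype V] (G : SimpleGraph V), Fintype.card V = n → C V G →
    (∃ D : Finset V, D.card = i ∧ IsDenseSet G k D) ∨
    (∃ S : Finset V, S.card = j ∧ IsSparseSet G k S)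

/-- `R_k^C(i, j) = n`: the number `n` is the smallest order such that all graphs on `n` vertices
in the class `C` have a `k`-dense `i`-set or a `k`-sparse `j`-set. -/
def IsDefectiveRamseyNumber (C : GraphClass.{u}) (k i j n : ℕ) : Prop :=
  IsLeast {m : ℕ | DefectiveRamseyProperty C k i j m} n

/-!
The problem is about graphs without four-cycles: in a bipartite graph, four vertices each
non-adjacent to at most one of the others form a four-cycle
(`exists_fourCycle_of_isDenseSet`, `isDenseSet_one_of_fourCycle`).

**Order 18.** A colour class with at least ten vertices contains an independent, hence `1`-sparse,
`10`-set. Otherwise both classes have nine vertices, and a bipartite graph without four-cycles is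
a system of nine lines on nine points, two lines sharing at most one point (`IsLinear`). A
`1`-sparse `10`-set is a set `Y` of lines and a set `X` of points, `|X| + |Y| = 10`, on which
incidence is a partial matching. Call a set `Y` of lines *irredundant* if each of its lines has a
point that lies on no other line of `Y`. Taking for `X` one private point of each line, together
with the points off all lines of `Y`, gives `|X| + |Y| = 9 - |⋃ Y| + 2 |Y|`; so an irredundant `Y`
with `|⋃ Y| < 2 |Y|` is enough (`hasSparseTen_of_irredundant`). For instance any five irredundant
lines are enough, so that a point lies on at most four lines unless a sparse set exists.

That every system has such a `Y` is shown by exhaustive search (`exhausts_two`, `exhausts_three`,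
`exhausts_four`), evaluated in the kernel. By duality the maximal degree `D ∈ {2, 3, 4}` may be
assumed to be attained at a point; this point is put last. The lines are encoded as binary numbers
and listed in decreasing order, so that the `D` lines through that point come first. Among all
numberings of the remaining points, one whose set of codes is largest in the colexicographic order
has its columns sorted (`exists_perm_columns_sorted`). The search runs through all such lists of
nine lines and abandons a branch as soon as two lines meet twice or the lines chosen so far contain
a small irredundant set; no branch reaches nine lines.

**Order at most 17.** The Möbius–Kantor graph, the incidence graph of the eight lines
`{i, i + 1, i + 3}` on the points of `ℤ/8`, has no four-cycle, and its `1`-sparse sets have at most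
eight vertices (`card_le_eight_of_isSparseSet`). Adding an isolated vertex gives a bipartite graph
of order 17 whose `1`-sparse sets have at most nine vertices; smaller orders are induced subgraphs
of it.
-/

open Finset

namespace PartialLinearSpace

/-! ### Sparse sets and irredundant sets of lines -/

/-- The incidence matrix `M` of nine lines (rows) and nine points (columns) is that of a partial
linear space: two distinct lines do not share two distinct points. -/
def IsLinear (M : Fin 9 → Fin 9 → Bool) : Prop :=
  ∀ i i' j j', i ≠ i' → j ≠ j' → M i j = true → M i j' = true → M i' j = true → M i' j' = true →
    False

/-- Some set `Y` of lines and set `X` of points, at least ten in all, on which the incidence `M`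
is a partial matching. -/
def HasSparseTen (M : Fin 9 → Fin 9 → Bool) : Prop :=
  ∃ X Y : Finset (Fin 9), 10 ≤ #X + #Y ∧
    (∀ i ∈ Y, ∀ j ∈ X, ∀ j' ∈ X, M i j = true → M i j' = true → j = j') ∧
    (∀ j ∈ X, ∀ i ∈ Y, ∀ i' ∈ Y, M i j = true → M i' j = true → i = i')

/-- If every line of `Y` has a private point and `Y` covers fewer than `2 |Y|` points, then the
private points together with the uncovered points form a large enough set of points. -/
theorem hasSparseTen_of_irredundant {M : Fin 9 → Fin 9 → Bool} {Y : Finset (Fin 9)}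
    (hpriv : ∀ i ∈ Y, ∃ j, M i j = true ∧ ∀ i' ∈ Y, i' ≠ i → M i' j = false)
    (hcard : #{j | ∃ i ∈ Y, M i j = true} < 2 * #Y) : HasSparseTen M := by
  classical
  choose! p hp hp' using hpriv
  have huniq : ∀ i ∈ Y, ∀ i' ∈ Y, M i' (p i) = true → i' = i := by
    intro i hi i' hi' h
    by_contra hne
    simp [hp' i hi i' hi' hne] at h
  have hinj : Set.InjOn p Y := by
    intro i hi i' hi' h
    exact huniq i' hi' i hi (h ▸ hp i hi)
  have hdisj : Disjoint (univ.filter fun j => ∀ i ∈ Y, M i j = false) (Y.image p) := by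
    rw [disjoint_left]
    intro j hj hj'
    obtain ⟨i, hi, rfl⟩ := mem_image.1 hj'
    have := (mem_filter.1 hj).2 i hi
    simp [hp i hi] at this
  have hcompl := card_filter_add_card_filter_not (s := (univ : Finset (Fin 9)))
    (fun j => ∃ i ∈ Y, M i j = true)
  refine ⟨(univ.filter fun j => ∀ i ∈ Y, M i j = false) ∪ Y.image p, Y, ?_, ?_, ?_⟩
  · rw [card_union_of_disjoint hdisj, card_image_of_injOn hinj]
    simp only [not_exists, not_and, Bool.not_eq_true, card_univ, Fintype.card_fin] at hcompl
    omega
  · have key : ∀ i ∈ Y, ∀ j ∈ (univ.filter fun j => ∀ i ∈ Y, M i j = false) ∪ Y.image p,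
        M i j = true → j = p i := by
      intro i hi j hj hij
      rcases mem_union.1 hj with hj | hj
      · simp [(mem_filter.1 hj).2 i hi] at hij
      · obtain ⟨k, hk, rfl⟩ := mem_image.1 hj
        rw [huniq k hk i hi hij]
    intro i hi j hj j' hj' h h'
    rw [key i hi j hj h, key i hi j' hj' h']
  · intro j hj i hi i' hi' h h'
    rcases mem_union.1 hj with hj | hj
    · simp [(mem_filter.1 hj).2 i hi] at h
    · obtain ⟨k, hk, rfl⟩ := mem_image.1 hj
      rw [huniq k hk i hi h, huniq k hk i' hi' h']

/-- A line with at most one point forms a sparse set together with all nine points. -/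
theorem two_le_card_row {M : Fin 9 → Fin 9 → Bool} (hM : ¬ HasSparseTen M) (i : Fin 9) :
    2 ≤ #{j | M i j = true} := by
  by_contra! h
  refine hM ⟨univ, {i}, by simp, ?_, ?_⟩
  · intro k hk j _ j' _ hj hj'
    rw [mem_singleton] at hk
    subst hk
    exact card_le_one.1 (Nat.lt_succ_iff.1 h) j (by simpa using hj) j' (by simpa using hj')
  · intro j _ i hi i' hi' _ _
    rw [mem_singleton.1 hi, mem_singleton.1 hi']

/-- Five lines through a point are irredundant, and they cover at most nine points. -/
theorem card_column_le_four {M : Fin 9 → Fin 9 → Bool} (hlin : IsLinear M)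
    (hM : ¬ HasSparseTen M) (j : Fin 9) : #{i | M i j = true} ≤ 4 := by
  by_contra! h
  obtain ⟨Y, hY, hYc⟩ := exists_subset_card_eq (Nat.succ_le_of_lt h)
  refine hM (hasSparseTen_of_irredundant (Y := Y) (fun i hi => ?_) ?_)
  · have hij := (mem_filter.1 (hY hi)).2
    obtain ⟨k, hk, hkj⟩ := exists_mem_ne (two_le_card_row hM i) j
    refine ⟨k, (mem_filter.1 hk).2, fun i' hi' hne => ?_⟩
    by_contra hc
    exact hlin i' i j k hne hkj.symm (mem_filter.1 (hY hi')).2 (by simpa using hc) hij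
      (mem_filter.1 hk).2
  · have := card_le_univ (univ.filter fun j => ∃ i ∈ Y, M i j = true)
    rw [Fintype.card_fin] at this
    omega

theorem hasSparseTen_of_transpose {M : Fin 9 → Fin 9 → Bool}
    (h : HasSparseTen fun i j => M j i) : HasSparseTen M := by
  obtain ⟨X, Y, hc, h1, h2⟩ := h
  exact ⟨Y, X, by omega, h2, h1⟩

/-! ### Sorting the points -/

/-- The incidence matrix after renumbering the points by `σ`. -/
def permuteCols (M : Fin 9 → Fin 9 → Bool) (σ : Equiv.Perm (Fin 9)) : Fin 9 → Fin 9 → Bool :=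
  fun i j => M i (σ j)

theorem HasSparseTen.of_permuteCols {M : Fin 9 → Fin 9 → Bool} {σ : Equiv.Perm (Fin 9)}
    (h : HasSparseTen (permuteCols M σ)) : HasSparseTen M := by
  obtain ⟨X, Y, hc, h1, h2⟩ := h
  refine ⟨X.map σ.toEmbedding, Y, by simpa using hc, ?_, ?_⟩
  · intro i hi j hj j' hj'
    obtain ⟨k, hk, rfl⟩ := mem_map.1 hj
    obtain ⟨k', hk', rfl⟩ := mem_map.1 hj'
    exact fun h h' => congrArg σ (h1 i hi k hk k' hk' h h')
  · intro j hj
    obtain ⟨k, hk, rfl⟩ := mem_map.1 hj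
    exact h2 k hk

/-- A line as a binary number: bit `j` tells whether point `j` lies on the line. -/
def code (M : Fin 9 → Fin 9 → Bool) (i : Fin 9) : ℕ := Nat.ofBits (M i)

theorem testBit_code (M : Fin 9 → Fin 9 → Bool) (i j : Fin 9) :
    (code M i).testBit j = M i j := by
  simp [code, Nat.testBit_ofBits_lt]

theorem testBit_code_of_le (M : Fin 9 → Fin 9 → Bool) (i : Fin 9) {c : ℕ} (hc : 9 ≤ c) :
    (code M i).testBit c = false :=
  Nat.testBit_ofBits_ge _ _ hc

theorem code_lt (M : Fin 9 → Fin 9 → Bool) (i : Fin 9) : code M i < 512 :=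
  Nat.ofBits_lt_two_pow _

theorem code_injective {M : Fin 9 → Fin 9 → Bool} (hlin : IsLinear M)
    (hrow : ∀ i, 2 ≤ #{j | M i j = true}) : Function.Injective (code M) := by
  intro i i' h
  by_contra hne
  obtain ⟨j, hj, k, hk, hjk⟩ := one_lt_card.1 (hrow i)
  simp only [mem_filter, mem_univ, true_and] at hj hk
  have heq : ∀ j, M i j = M i' j := fun j => by
    rw [← testBit_code M i, h, testBit_code]
  exact hlin i i' j k hne hjk hj hk (heq j ▸ hj) (heq k ▸ hk)

theorem permuteCols_trans (M : Fin 9 → Fin 9 → Bool) (τ σ : Equiv.Perm (Fin 9)) :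
    permuteCols M (τ.trans σ) = permuteCols (permuteCols M σ) τ := rfl

theorem IsLinear.permuteCols {M : Fin 9 → Fin 9 → Bool} (hlin : IsLinear M)
    (σ : Equiv.Perm (Fin 9)) : IsLinear (permuteCols M σ) :=
  fun i i' _ _ hi hj => hlin i i' _ _ hi (σ.injective.ne hj)

theorem card_row_permuteCols (M : Fin 9 → Fin 9 → Bool) (σ : Equiv.Perm (Fin 9)) (i : Fin 9) :
    #{j | permuteCols M σ i j = true} = #{j | M i j = true} :=
  card_equiv σ fun j => by rw [mem_filter, mem_filter]; simp [permuteCols]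

theorem code_permuteCols_swap {M : Fin 9 → Fin 9 → Bool} {i a b : Fin 9} (h : M i a = M i b) :
    code (permuteCols M (Equiv.swap a b)) i = code M i := by
  refine congrArg Nat.ofBits (funext fun k => ?_)
  unfold permuteCols
  rw [Equiv.swap_apply_def]
  split_ifs with hka hkb
  · rw [hka, h]
  · rw [hkb, h]
  · rfl

theorem code_lt_code_permuteCols_swap {M : Fin 9 → Fin 9 → Bool} {i a b : Fin 9} (hab : a < b)
    (ha : M i a = true) (hb : M i b = false) :
    code M i < code (permuteCols M (Equiv.swap a b)) i := by
  refine Nat.lt_of_testBit b.val ?_ ?_ fun k hk => ?_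
  · rw [testBit_code, hb]
  · rw [testBit_code, permuteCols, Equiv.swap_apply_right, ha]
  · rcases lt_or_ge k 9 with hk9 | hk9
    · lift k to Fin 9 using hk9
      rw [testBit_code, testBit_code, permuteCols, Equiv.swap_apply_of_ne_of_ne]
      · exact (hab.trans hk).ne'
      · exact Fin.ne_of_gt hk
    · rw [testBit_code_of_le _ _ hk9, testBit_code_of_le _ _ hk9]

/-- Raising the value at `i` and keeping all values above `f i` raises the set of values in the
colexicographic order, whatever happens to the values below `f i`. -/
theorem toColex_image_lt {ι : Type*} [Fintype ι] [DecidableEq ι] {f g : ι → ℕ}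
    (hg : Function.Injective g) {i : ι} (hi : f i < g i) (hfix : ∀ k, f i < f k → g k = f k) :
    toColex (univ.image f) < toColex (univ.image g) := by
  have hnot : g i ∉ univ.image f := by
    intro hmem
    obtain ⟨k, -, hk⟩ := mem_image.1 hmem
    have : k = i := hg ((hfix k (hk ▸ hi)).trans hk)
    rw [this] at hk
    omega
  refine lt_of_le_of_ne ?_ fun h =>
    hnot (toColex_inj.1 h ▸ mem_image_of_mem _ (mem_univ i))
  rw [Finset.Colex.toColex_le_toColex]
  intro x hx hx'
  obtain ⟨k, -, rfl⟩ := mem_image.1 hx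
  refine ⟨_, mem_image_of_mem _ (mem_univ i), hnot, ?_⟩
  by_contra! hlt
  exact hx' (mem_image.2 ⟨k, mem_univ k, hfix k (hi.trans hlt)⟩)

/-- The points can be numbered so that `p` is the last one and, for points `a < b < 8`, the first
line in decreasing order of codes that distinguishes `a` from `b` contains `b`. Here `σ` is chosen
so as to make the set of codes colexicographically largest; a violation would allow an improvement
by exchanging `a` and `b`. -/
theorem exists_perm_columns_sorted {M : Fin 9 → Fin 9 → Bool} (hlin : IsLinear M)
    (hrow : ∀ i, 2 ≤ #{j | M i j = true}) (p : Fin 9) :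
    ∃ σ : Equiv.Perm (Fin 9), σ 8 = p ∧ ∀ i a b, a < b → b < 8 →
      permuteCols M σ i a = true → permuteCols M σ i b = false →
      ∃ i', code (permuteCols M σ) i < code (permuteCols M σ) i' ∧
        permuteCols M σ i' a ≠ permuteCols M σ i' b := by
  classical
  have hinj : ∀ σ, Function.Injective (code (permuteCols M σ)) := fun σ =>
    code_injective (hlin.permuteCols σ) fun i => (card_row_permuteCols M σ i).symm ▸ hrow i
  have : Nonempty {σ : Equiv.Perm (Fin 9) // σ 8 = p} := ⟨⟨Equiv.swap 8 p, by simp⟩⟩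
  obtain ⟨⟨σ, hσ⟩, hmax⟩ := Finite.exists_max fun σ : {σ : Equiv.Perm (Fin 9) // σ 8 = p} =>
    toColex (univ.image (code (permuteCols M σ.1)))
  refine ⟨σ, hσ, fun i a b hab hb h1 h2 => ?_⟩
  by_contra! hc
  have hτ8 : (Equiv.swap a b).trans σ 8 = p := by
    rw [Equiv.trans_apply, Equiv.swap_apply_of_ne_of_ne (hab.trans hb).ne' hb.ne', hσ]
  have hlt : toColex (univ.image (code (permuteCols M σ))) <
      toColex (univ.image (code (permuteCols M ((Equiv.swap a b).trans σ)))) := by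
    rw [permuteCols_trans]
    refine toColex_image_lt ?_ (code_lt_code_permuteCols_swap hab h1 h2) fun k hk =>
      code_permuteCols_swap (hc k hk)
    rw [← permuteCols_trans]
    exact hinj _
  have hle := hmax ⟨(Equiv.swap a b).trans σ, hτ8⟩
  exact absurd hle hlt.not_ge

/-! ### The exhaustive search -/

/-- `p r cs` holds for every element `r` of the list, where `cs` is the part of the list after
`r`. -/
def forallTails (p : ℕ → List ℕ → Bool) : List ℕ → Bool
  | [] => true
  | r :: cs => p r cs && forallTails p cs

/-- Whether no list of `k` candidates, taken in the order of `cands`, extends `rows` in such a way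
that each new row passes `canon` at its turn and is compatible (`ok`) with what precedes it.
The rows chosen so far are kept latest first; the compatibility of a candidate is tested again each
time that a row is added. -/
def exhausts (canon ok : List ℕ → ℕ → Bool) : ℕ → List ℕ → List ℕ → Bool
  | 0, _, _ => false
  | k + 1, rows, cands => forallTails (fun r cs =>
      !canon rows r || exhausts canon ok k (r :: rows) (cs.filter (ok (r :: rows)))) cands

/-- `f n`, where `n` is evaluated to a numeral before `f` is applied to it. -/
def strict {α : Type} (f : ℕ → α) : ℕ → α
  | 0 => f 0
  | n + 1 => f (n + 1)

/-- The number of ones among the nine lowest binary digits. -/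
def popCount : ℕ → ℕ := strict fun m =>
  m % 2 + m / 2 % 2 + m / 4 % 2 + m / 8 % 2 + m / 16 % 2 + m / 32 % 2 + m / 64 % 2 +
    m / 128 % 2 + m / 256 % 2

/-- Every line of `F` has a point outside `tw`, the set of points covered at least twice. -/
def hasPrivate (F : List ℕ) (tw : ℕ) : Bool :=
  F.all fun f => !Nat.beq (f ||| tw) tw

/-- Whether the family `F`, enlarged by some of the lines in `rows`, becomes an irredundant
family that covers fewer than twice as many points as it has lines. The points covered by `F` are
the digits of `o`; those covered at least twice are the digits of `tw`. A line is added only if the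
family remains irredundant, which loses nothing as subfamilies of irredundant families are
irredundant. -/
def findSmall : List ℕ → List ℕ → ℕ → ℕ → Bool
  | [], F, o, tw => hasPrivate F tw && Nat.blt (popCount o) (2 * F.length)
  | r :: rows, F, o, tw => findSmall rows F o tw ||
      strict (fun tw' => hasPrivate (r :: F) tw' &&
        strict (fun o' => findSmall rows (r :: F) o' tw') (o ||| r)) (tw ||| (o &&& r))

/-- The line `y` meets the latest line `r` at most once, and `r`, `y` and the earlier lines give no
small irredundant family that contains both `r` and `y`. -/
def compat : List ℕ → ℕ → Bool
  | [], _ => true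
  | r :: rows, y => Nat.ble (popCount (r &&& y)) 1 &&
      !strict (fun o => strict (fun tw => findSmall rows [r, y] o tw) (y &&& r)) (y ||| r)

/-- The normal form imposed on a line `r` that follows the lines `rows`: the first `D` lines, and
only they, contain point `8`; and if `r` contains point `c` but not `c + 1`, where `c + 1 < 8`, then
an earlier line distinguishes these points. -/
def canon (D : ℕ) (rows : List ℕ) (r : ℕ) : Bool :=
  (Nat.blt rows.length D == r.testBit 8) &&
  (List.range 7).all fun c => !r.testBit c || r.testBit (c + 1) ||
    rows.any fun s => s.testBit c != s.testBit (c + 1)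

/-- The codes of the sets of at least two and at most `D` points, in decreasing order. -/
def candidates (D : ℕ) : List ℕ :=
  (List.range 512).reverse.filter fun m => Nat.ble 2 (popCount m) && Nat.ble (popCount m) D

theorem strict_apply {α : Type} (f : ℕ → α) (n : ℕ) : strict f n = f n := by
  cases n <;> rfl

/-! ### Soundness of the search -/

theorem exists_tail_of_forallTails {p : ℕ → List ℕ → Bool} {r : ℕ} {L l : List ℕ}
    (h : forallTails p l = true) (hL : (r :: L).Sublist l) :
    ∃ cs, p r cs = true ∧ L.Sublist cs := by
  induction l with
  | nil => cases hL
  | cons a l ih =>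
    simp only [forallTails, Bool.and_eq_true] at h
    cases hL with
    | cons _ h' => exact ih h.2 h'
    | cons_cons _ h' => exact ⟨l, h.1, h'⟩

/-- If the search is exhaustive, then any sublist of the candidates of the given length violates
one of the two tests somewhere. -/
theorem exists_violation_of_exhausts {canon ok : List ℕ → ℕ → Bool} (L : List ℕ) :
    ∀ rows cands : List ℕ, exhausts canon ok L.length rows cands = true → L.Sublist cands →
      ∃ l₁ r l₂, L = l₁ ++ r :: l₂ ∧ (canon (l₁.reverse ++ rows) r = false ∨
        ∃ y ∈ l₂, ok (r :: (l₁.reverse ++ rows)) y = false) := by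
  induction L with
  | nil => intro rows cands h; simp [exhausts] at h
  | cons r L ih =>
    intro rows cands h hL
    obtain ⟨cs, hp, hcs⟩ := exists_tail_of_forallTails h hL
    simp only [Bool.or_eq_true, Bool.not_eq_true'] at hp
    rcases hp with hp | hp
    · exact ⟨[], r, L, rfl, Or.inl hp⟩
    by_cases hok : ∀ y ∈ L, ok (r :: rows) y = true
    · have hf := hcs.filter (ok (r :: rows))
      rw [List.filter_eq_self.2 hok] at hf
      obtain ⟨l₁, s, l₂, rfl, hs⟩ := ih _ _ hp hf
      exact ⟨r :: l₁, s, l₂, rfl, by simpa using hs⟩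
    · push Not at hok
      obtain ⟨y, hy, hy'⟩ := hok
      exact ⟨[], r, L, rfl, Or.inr ⟨y, hy, by simpa using hy'⟩⟩

theorem popCount_eq_card (m : ℕ) :
    popCount m = (Finset.univ.filter fun j : Fin 9 => m.testBit j = true).card := by
  have h : ∀ x : ℕ, (if x % 2 = 1 then 1 else 0) = x % 2 := fun x => by split <;> omega
  simp [popCount, strict_apply, Finset.card_filter, Fin.sum_univ_succ,
    Nat.testBit_eq_decide_div_mod_eq, h, Fin.succ]
  omega

theorem exists_private_of_hasPrivate {F : List ℕ} {tw f : ℕ} (h : hasPrivate F tw = true)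
    (hf : f ∈ F) : ∃ j, f.testBit j = true ∧ tw.testBit j = false := by
  have h1 := List.all_eq_true.1 h f hf
  by_contra! hc
  have : f ||| tw = tw := by
    refine Nat.eq_of_testBit_eq fun j => ?_
    rw [Nat.testBit_or]
    cases hj : f.testBit j
    · simp
    · simpa using hc j hj
  simp [this] at h1

/-- The bookkeeping of `findSmall`: `o` is the set of points covered by `F`, and `tw` contains all
points covered at least twice. -/
structure Tracks (F : List ℕ) (o tw : ℕ) : Prop where
  nodup : F.Nodup
  mem_union : ∀ j, o.testBit j = true ↔ ∃ f ∈ F, f.testBit j = true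
  mem_twice : ∀ j, ∀ f ∈ F, ∀ g ∈ F, f ≠ g → f.testBit j = true → g.testBit j = true →
    tw.testBit j = true

theorem Tracks.cons {F : List ℕ} {o tw r : ℕ} (h : Tracks F o tw) (hr : r ∉ F) :
    Tracks (r :: F) (o ||| r) (tw ||| (o &&& r)) where
  nodup := List.nodup_cons.2 ⟨hr, h.nodup⟩
  mem_union j := by
    simp only [Nat.testBit_or, Bool.or_eq_true, h.mem_union, List.mem_cons, exists_eq_or_imp]
    exact or_comm
  mem_twice j f hf₀ g hg₀ hfg hfj hgj := by
    simp only [Nat.testBit_or, Nat.testBit_and, Bool.or_eq_true, Bool.and_eq_true, h.mem_union]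
    rcases List.mem_cons.1 hf₀ with rfl | hf <;> rcases List.mem_cons.1 hg₀ with rfl | hg
    · exact absurd rfl hfg
    · exact Or.inr ⟨⟨g, hg, hgj⟩, hfj⟩
    · exact Or.inr ⟨⟨f, hf, hfj⟩, hgj⟩
    · exact Or.inl (h.mem_twice j f hf g hg hfg hfj hgj)

/-- A family of distinct lines, given by codes, in which each line has a private point and which
covers fewer than twice as many points as it has lines. -/
def IsSmallIrredundant (F : List ℕ) : Prop :=
  F.Nodup ∧ (∀ f ∈ F, ∃ j, f.testBit j = true ∧ ∀ g ∈ F, g ≠ f → g.testBit j = false) ∧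
    (Finset.univ.filter fun j : Fin 9 => ∃ f ∈ F, f.testBit j = true).card < 2 * F.length

theorem exists_smallIrredundant_of_findSmall (rows : List ℕ) :
    ∀ (F : List ℕ) (o tw : ℕ), findSmall rows F o tw = true → Tracks F o tw →
      (rows ++ F).Nodup → ∃ F', F' ⊆ rows ++ F ∧ IsSmallIrredundant F' := by
  induction rows with
  | nil =>
    intro F o tw h hT _
    simp only [findSmall, Bool.and_eq_true, Nat.blt_eq] at h
    refine ⟨F, by simp, hT.nodup, fun f hf => ?_, ?_⟩
    · obtain ⟨j, hj, hj'⟩ := exists_private_of_hasPrivate h.1 hf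
      refine ⟨j, hj, fun g hg hgf => ?_⟩
      by_contra hc
      simp [hT.mem_twice j g hg f hf hgf (by simpa using hc) hj] at hj'
    · simpa only [popCount_eq_card, hT.mem_union] using h.2
  | cons r rows ih =>
    intro F o tw h hT hnd
    simp only [findSmall, Bool.or_eq_true, strict_apply, Bool.and_eq_true] at h
    rw [List.cons_append, List.nodup_cons] at hnd
    rcases h with h | ⟨-, h⟩
    · obtain ⟨F', hF', hs⟩ := ih F o tw h hT hnd.2
      exact ⟨F', fun x hx => List.mem_cons_of_mem _ (hF' hx), hs⟩
    · have hr : r ∉ F := fun hr => hnd.1 (List.mem_append_right _ hr)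
      have hp : (rows ++ r :: F).Perm (r :: (rows ++ F)) := List.perm_middle
      obtain ⟨F', hF', hs⟩ := ih _ _ _ h (hT.cons hr) (hp.nodup_iff.2 (List.nodup_cons.2 hnd))
      exact ⟨F', fun x hx => hp.subset (hF' hx), hs⟩

theorem exists_smallIrredundant_of_compat_eq_false {rows : List ℕ} {r y : ℕ}
    (h : compat (r :: rows) y = false) (hnd : (y :: r :: rows).Nodup)
    (hry : (Finset.univ.filter fun j : Fin 9 => r.testBit j = true ∧ y.testBit j = true).card ≤ 1) :
    ∃ F, F ⊆ y :: r :: rows ∧ IsSmallIrredundant F := by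
  have h1 : Nat.ble (popCount (r &&& y)) 1 = true := by
    simpa [popCount_eq_card, Nat.testBit_and] using hry
  simp only [compat, h1, strict_apply, Bool.true_and, Bool.not_eq_false'] at h
  have hT : Tracks [y] y 0 := ⟨by simp, by simp, by
    intro j f hf g hg hfg
    simp only [List.mem_singleton] at hf hg
    exact absurd (hf.trans hg.symm) hfg⟩
  have hyr : r ∉ [y] := by
    simp only [List.nodup_cons, List.mem_cons, not_or] at hnd
    simpa using Ne.symm hnd.1.1
  have hT2 := hT.cons hyr
  rw [Nat.zero_or] at hT2
  have hp : (rows ++ [r, y]).Perm (y :: r :: rows) :=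
    List.perm_append_comm.trans (List.Perm.swap y r rows)
  obtain ⟨F, hF, hs⟩ := exists_smallIrredundant_of_findSmall rows _ _ _ h hT2 (hp.nodup_iff.2 hnd)
  exact ⟨F, fun x hx => hp.subset (hF hx), hs⟩

/-! ### Nine lines on nine points -/

theorem exhausts_two : exhausts (canon 2) compat 9 [] (candidates 2) = true := by decide +kernel
theorem exhausts_three : exhausts (canon 3) compat 9 [] (candidates 3) = true := by decide +kernel
theorem exhausts_four : exhausts (canon 4) compat 9 [] (candidates 4) = true := by decide +kernel

theorem not_isSmallIrredundant_of_subset {M : Fin 9 → Fin 9 → Bool} (hM : ¬ HasSparseTen M)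
    (hinj : Function.Injective (code M)) {F : List ℕ} (hF : ∀ f ∈ F, ∃ i, code M i = f) :
    ¬ IsSmallIrredundant F := by
  rintro ⟨hnd, hpriv, hcard⟩
  have hlen : #{i | code M i ∈ F} = F.length := by
    rw [← List.toFinset_card_of_nodup hnd, ← card_image_of_injective _ hinj]
    congr 1
    ext f
    simp only [mem_image, mem_filter, mem_univ, true_and, List.mem_toFinset]
    constructor
    · rintro ⟨i, hi, rfl⟩
      exact hi
    · intro hf
      obtain ⟨i, rfl⟩ := hF f hf
      exact ⟨i, hf, rfl⟩
  refine hM (hasSparseTen_of_irredundant (Y := univ.filter fun i => code M i ∈ F)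
    (fun i hi => ?_) ?_)
  · obtain ⟨j, hj, hj'⟩ := hpriv _ (mem_filter.1 hi).2
    have hj9 : j < 9 := by
      by_contra! h
      simp [testBit_code_of_le M i h] at hj
    lift j to Fin 9 using hj9
    refine ⟨j, by rwa [testBit_code] at hj, fun i' hi' hne => ?_⟩
    have := hj' _ (mem_filter.1 hi').2 (hinj.ne hne)
    rwa [testBit_code] at this
  · rw [hlen]
    refine lt_of_le_of_lt (card_le_card fun j hj => ?_) hcard
    obtain ⟨i, hi, hij⟩ := (mem_filter.1 hj).2
    exact mem_filter.2 ⟨mem_univ _, _, (mem_filter.1 hi).2, by rwa [testBit_code]⟩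

theorem code_mem_candidates {M : Fin 9 → Fin 9 → Bool} {D : ℕ} {i : Fin 9}
    (h2 : 2 ≤ #{j | M i j = true}) (hD : #{j | M i j = true} ≤ D) :
    code M i ∈ candidates D := by
  simp only [candidates, List.mem_filter, List.mem_reverse, List.mem_range, Bool.and_eq_true,
    Nat.ble_eq, popCount_eq_card, testBit_code]
  exact ⟨code_lt M i, h2, hD⟩

theorem pairwise_candidates (D : ℕ) : (candidates D).Pairwise (· > ·) := by
  have h : ∀ n : ℕ, (List.range n).reverse.Pairwise (· > ·) := fun n =>
    List.pairwise_reverse.2 List.pairwise_lt_range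
  exact (h 512).filter _

/-- The list of the codes of a partial linear space in normal form, in decreasing order, passes all
tests of the search, unless a sparse set exists. -/
theorem false_of_exhausts_of_sorted {M : Fin 9 → Fin 9 → Bool} {D : ℕ}
    (hex : exhausts (canon D) compat 9 [] (candidates D) = true) (hlin : IsLinear M)
    (hM : ¬ HasSparseTen M) (hrow : ∀ i, #{j | M i j = true} ≤ D)
    (hcol : #{i | M i 8 = true} = D)
    (hsort : ∀ i a b, a < b → b < 8 → M i a = true → M i b = false →
      ∃ i', code M i < code M i' ∧ M i' a ≠ M i' b) : False := by
  have hinj := code_injective hlin (two_le_card_row hM)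
  obtain ⟨L, hmem, hgt, hlen⟩ : ∃ L : List ℕ, (∀ x, x ∈ L ↔ ∃ i, code M i = x) ∧
      L.Pairwise (· > ·) ∧ L.length = 9 :=
    ⟨(univ.image (code M)).sort (· ≥ ·), by simp, (sortedGT_sort _).pairwise, by
      rw [length_sort, card_image_of_injective _ hinj, card_univ, Fintype.card_fin]⟩
  have hnd : L.Nodup := hgt.imp fun h => ne_of_gt h
  have hsub : L.Sublist (candidates D) := by
    refine List.sublist_of_subperm_of_pairwise (r := (· > ·)) ?_ hgt ?_
    · refine hnd.subperm fun x hx => ?_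
      obtain ⟨i, rfl⟩ := (hmem x).1 hx
      exact code_mem_candidates (two_le_card_row hM i) (hrow i)
    · exact pairwise_candidates D
  have hcount : L.countP (fun x => x.testBit 8) = D := by
    rw [← hcol, List.countP_eq_length_filter,
      ← List.toFinset_card_of_nodup (hnd.filter _),
      ← card_image_of_injective _ hinj]
    refine congrArg card (ext fun x => ?_)
    simp only [List.mem_toFinset, List.mem_filter, hmem, mem_image, mem_filter, mem_univ, true_and]
    constructor
    · rintro ⟨⟨i, rfl⟩, h⟩
      exact ⟨i, (testBit_code M i 8).symm.trans h, rfl⟩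
    · rintro ⟨i, h, rfl⟩
      exact ⟨⟨i, rfl⟩, (testBit_code M i 8).trans h⟩
  have hbit : ∀ x ∈ L, (x.testBit 8 = true ↔ 256 ≤ x) := by
    intro x hx
    obtain ⟨i, rfl⟩ := (hmem x).1 hx
    have := code_lt M i
    rw [Nat.testBit_eq_decide_div_mod_eq, decide_eq_true_iff]
    omega
  rw [← hlen] at hex
  obtain ⟨l₁, r, l₂, hLr, hviol⟩ := exists_violation_of_exhausts L [] _ hex hsub
  rw [List.append_nil] at hviol
  have hr : r ∈ L := by simp [hLr]
  have h₁ : ∀ x ∈ l₁, x ∈ L ∧ r < x := fun x hx =>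
    ⟨by simp [hLr, hx], (List.pairwise_append.1 (hLr ▸ hgt)).2.2 x hx r (by simp)⟩
  have h₂ : ∀ x ∈ l₂, x ∈ L ∧ x < r := fun x hx =>
    ⟨by simp [hLr, hx], (List.pairwise_cons.1 (List.pairwise_append.1 (hLr ▸ hgt)).2.1).1 x hx⟩
  rcases hviol with hviol | ⟨y, hy, hviol⟩
  -- The first test fails neither in its first part, since the codes with digit `8` are those from
  -- `256` on and there are `D` of them, nor in its second part, since the points are sorted.
  · have hpencil : Nat.blt l₁.reverse.length D = r.testBit 8 := by
      rw [hLr, List.countP_append, List.countP_cons] at hcount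
      rw [List.length_reverse, Bool.eq_iff_iff, Nat.blt_eq]
      constructor
      · intro hlt
        by_contra hr8
        rw [if_neg hr8, List.countP_eq_zero.2 fun x hx h => hr8 ((hbit r hr).2
          (((hbit x (h₂ x hx).1).1 h).trans (h₂ x hx).2.le))] at hcount
        have := l₁.countP_le_length (p := fun x => x.testBit 8)
        omega
      · intro hr8
        rw [if_pos hr8, List.countP_eq_length.2 fun x hx => (hbit x (h₁ x hx).1).2
          (((hbit r hr).1 hr8).trans (h₁ x hx).2.le)] at hcount
        omega
    simp only [canon, hpencil, beq_self_eq_true, Bool.true_and, List.all_eq_false,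
      List.mem_range, Bool.not_eq_true, Bool.or_eq_false_iff, Bool.not_eq_false',
      List.any_eq_false, List.mem_reverse, bne_eq_false_iff_eq] at hviol
    obtain ⟨c, hc, ⟨hca, hcb⟩, hall⟩ := hviol
    obtain ⟨i, rfl⟩ := (hmem r).1 hr
    obtain ⟨i', hi', hne⟩ := hsort i ⟨c, by omega⟩ ⟨c + 1, by omega⟩ (by simp)
      (by simp [Fin.lt_def]; omega) ((testBit_code M i _).symm.trans hca)
      ((testBit_code M i _).symm.trans hcb)
    have hmem' : code M i' ∈ l₁ := by
      have : code M i' ∈ L := (hmem _).2 ⟨i', rfl⟩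
      rw [hLr, List.mem_append, List.mem_cons] at this
      rcases this with h | h | h
      · exact h
      · omega
      · have := (h₂ _ h).2
        omega
    have e1 := testBit_code M i' ⟨c, by omega⟩
    have e2 := testBit_code M i' ⟨c + 1, by omega⟩
    rw [← e1, ← e2] at hne
    exact hne (hall _ hmem')
  -- The second test fails only if there is a small irredundant family.
  · have hyL := (h₂ y hy)
    have hsubL : ∀ x ∈ y :: r :: l₁.reverse, x ∈ L := by
      intro x hx
      simp only [List.mem_cons, List.mem_reverse] at hx
      rcases hx with rfl | rfl | hx
      exacts [hyL.1, hr, (h₁ x hx).1]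
    obtain ⟨F, hF, hsmall⟩ := exists_smallIrredundant_of_compat_eq_false hviol (by
      simp only [List.nodup_cons, List.mem_cons, List.mem_reverse, List.nodup_reverse, not_or]
      refine ⟨⟨hyL.2.ne, fun h => ?_⟩, fun h => ?_, ?_⟩
      · exact lt_asymm hyL.2 (h₁ y h).2
      · exact lt_irrefl _ (h₁ r h).2
      · rw [hLr] at hnd
        exact (List.nodup_append.1 hnd).1) (by
      obtain ⟨i, rfl⟩ := (hmem r).1 hr
      obtain ⟨i', rfl⟩ := (hmem y).1 hyL.1
      refine card_le_one.2 fun a ha b hb => ?_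
      simp only [mem_filter, mem_univ, true_and, testBit_code] at ha hb
      by_contra hab
      refine hlin i i' a b (fun h => ?_) hab ha.1 hb.1 ha.2 hb.2
      rw [h] at hyL
      exact lt_irrefl _ hyL.2)
    exact not_isSmallIrredundant_of_subset hM hinj
      (fun f hf => (hmem f).1 (hsubL f (hF hf))) hsmall

theorem false_of_exhausts {M : Fin 9 → Fin 9 → Bool} {D : ℕ}
    (hex : exhausts (canon D) compat 9 [] (candidates D) = true) (hlin : IsLinear M)
    (hM : ¬ HasSparseTen M) (hrow : ∀ i, #{j | M i j = true} ≤ D) {p : Fin 9}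
    (hcol : #{i | M i p = true} = D) : False := by
  obtain ⟨σ, hσ, hsort⟩ := exists_perm_columns_sorted hlin (two_le_card_row hM) p
  refine false_of_exhausts_of_sorted hex (hlin.permuteCols σ) (fun h => hM h.of_permuteCols)
    (fun i => (card_row_permuteCols M σ i).trans_le (hrow i)) ?_ hsort
  simpa only [permuteCols, hσ] using hcol

theorem false_of_column_maximal {M : Fin 9 → Fin 9 → Bool} (hlin : IsLinear M)
    (hM : ¬ HasSparseTen M) {p : Fin 9}
    (hp : ∀ i, #{j | M i j = true} ≤ #{i | M i p = true}) : False := by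
  have h4 := card_column_le_four hlin hM p
  have h2 := (two_le_card_row hM 0).trans (hp 0)
  obtain ⟨D, hD⟩ : ∃ D, #{i | M i p = true} = D := ⟨_, rfl⟩
  rw [hD] at hp h2 h4
  interval_cases D
  · exact false_of_exhausts exhausts_two hlin hM hp hD
  · exact false_of_exhausts exhausts_three hlin hM hp hD
  · exact false_of_exhausts exhausts_four hlin hM hp hD

/-- Every system of nine lines on nine points has a sparse set of ten elements: by duality, the
largest degree may be assumed to be that of a point. -/
theorem IsLinear.hasSparseTen {M : Fin 9 → Fin 9 → Bool} (hlin : IsLinear M) :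
    HasSparseTen M := by
  by_contra hM
  obtain ⟨p, hp⟩ := Finite.exists_max fun p => #{i | M i p = true}
  obtain ⟨q, hq⟩ := Finite.exists_max fun q => #{j | M q j = true}
  rcases le_total #{j | M q j = true} #{i | M i p = true} with h | h
  · exact false_of_column_maximal hlin hM fun i => (hq i).trans h
  · exact false_of_column_maximal (M := fun i j => M j i) (p := q)
      (fun i i' j j' hi hj h1 h2 h3 h4 => hlin j j' i i' hj hi h1 h3 h2 h4)
      (fun h' => hM (hasSparseTen_of_transpose h')) fun i => (hp i).trans h

end PartialLinearSpace

/-! ### Sparse and dense sets of graphs -/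

theorem IsSparseSet.of_isIndep {V : Type*} {G : SimpleGraph V} {k : ℕ} {S : Finset V}
    (h : ∀ v ∈ S, ∀ w ∈ S, ¬ G.Adj v w) : IsSparseSet G k S := by
  intro v hv
  have : {w : V | w ∈ S ∧ G.Adj v w} = ∅ :=
    Set.eq_empty_of_forall_notMem fun w hw => h v hv w hw.1 hw.2
  simp [this]

theorem isSparseSet_one_of_unique {V : Type*} {G : SimpleGraph V} {S : Finset V}
    (h : ∀ v ∈ S, ∀ w ∈ S, ∀ w' ∈ S, G.Adj v w → G.Adj v w' → w = w') : IsSparseSet G 1 S := by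
  intro v hv
  rw [Set.ncard_le_one ((Finset.finite_toSet S).subset fun w hw => hw.1)]
  exact fun w hw w' hw' => h v hv w hw.1 w' hw'.1 hw.2 hw'.2

theorem IsSparseSet.eq_of_adj {V : Type*} {G : SimpleGraph V} {S : Finset V}
    (h : IsSparseSet G 1 S) {v w w' : V} (hv : v ∈ S) (hw : w ∈ S) (hw' : w' ∈ S)
    (hvw : G.Adj v w) (hvw' : G.Adj v w') : w = w' := by
  have := h v hv
  rw [Set.ncard_le_one ((Finset.finite_toSet S).subset fun w hw => hw.1)] at this
  exact this w ⟨hw, hvw⟩ w' ⟨hw', hvw'⟩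

theorem IsSparseSet.subset {V : Type*} {G : SimpleGraph V} {k : ℕ} {S T : Finset V}
    (h : IsSparseSet G k T) (hST : S ⊆ T) : IsSparseSet G k S := fun v hv =>
  (Set.ncard_le_ncard (t := {w | w ∈ T ∧ G.Adj v w}) (fun _ hw => ⟨hST hw.1, hw.2⟩)
    (T.finite_toSet.subset fun _ hw => hw.1)).trans (h v (hST hv))

theorem isDenseSet_one_of_fourCycle {V : Type*} [DecidableEq V] {G : SimpleGraph V} {a b c d : V}
    (hac : G.Adj a c) (had : G.Adj a d) (hbc : G.Adj b c) (hbd : G.Adj b d) :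
    IsDenseSet G 1 {a, b, c, d} := by
  refine isSparseSet_one_of_unique ?_
  simp only [mem_insert, mem_singleton, SimpleGraph.compl_adj]
  rintro v (rfl | rfl | rfl | rfl) w (rfl | rfl | rfl | rfl) w' (rfl | rfl | rfl | rfl) ⟨h1, h2⟩
    ⟨h3, h4⟩ <;> first
    | rfl
    | exact absurd rfl h1
    | exact absurd rfl h3
    | exact absurd ‹_› h2
    | exact absurd ‹_› h4
    | exact absurd (SimpleGraph.Adj.symm ‹_›) h2
    | exact absurd (SimpleGraph.Adj.symm ‹_›) h4

theorem exists_fourCycle_of_isDenseSet {V : Type*} {G : SimpleGraph V} (hG : G.IsBipartite)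
    {D : Finset V} (hD : IsDenseSet G 1 D) (hcard : #D = 4) :
    ∃ a b c d, a ≠ b ∧ c ≠ d ∧ G.Adj a c ∧ G.Adj a d ∧ G.Adj b c ∧ G.Adj b d := by
  classical
  obtain ⟨col⟩ := hG
  have hle : ∀ t : Fin 2, #{v ∈ D | col v = t} ≤ 2 := by
    intro t
    by_contra! h
    obtain ⟨x, y, z, hx, hy, hz, hxy, hxz, hyz⟩ := two_lt_card_iff.1 h
    simp only [mem_filter] at hx hy hz
    have hnadj : ∀ v w, col v = t → col w = t → ¬ G.Adj v w := fun v w hv hw hvw =>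
      col.valid hvw (hv.trans hw.symm)
    -- Among three vertices of one colour, `x` has the two non-neighbours `y` and `z`.
    exact hyz (hD.eq_of_adj hx.1 hy.1 hz.1
      ((SimpleGraph.compl_adj _ _ _).2 ⟨hxy, hnadj x y hx.2 hy.2⟩)
      ((SimpleGraph.compl_adj _ _ _).2 ⟨hxz, hnadj x z hx.2 hz.2⟩))
  have hsum := card_eq_sum_card_fiberwise (s := D) (f := col) (t := univ) (by simp)
  rw [Fin.sum_univ_two, hcard] at hsum
  have h0 := hle 0
  have h1 := hle 1
  obtain ⟨a, b, hab, hA⟩ := card_eq_two.1 (show #{v ∈ D | col v = 0} = 2 by omega)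
  obtain ⟨c, d, hcd, hB⟩ := card_eq_two.1 (show #{v ∈ D | col v = 1} = 2 by omega)
  have hmA : ∀ v ∈ ({a, b} : Finset V), v ∈ D ∧ col v = 0 := fun v hv => by
    rwa [← hA, mem_filter] at hv
  have hmB : ∀ v ∈ ({c, d} : Finset V), v ∈ D ∧ col v = 1 := fun v hv => by
    rwa [← hB, mem_filter] at hv
  have hadj : ∀ v ∈ ({a, b} : Finset V), ∀ v' ∈ ({a, b} : Finset V), v ≠ v' →
      ∀ w ∈ ({c, d} : Finset V), G.Adj v w := by
    intro v hv v' hv' hne w hw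
    by_contra hvw
    have hne' : ∀ u ∈ ({a, b} : Finset V), u ≠ w := fun u hu h => by
      have := (hmA u hu).2
      rw [h, (hmB w hw).2] at this
      exact absurd this (by decide)
    -- Otherwise `v` has two non-neighbours in `D`, namely `v'` and `w`.
    refine hne' v' hv' (hD.eq_of_adj (hmA v hv).1 (hmA v' hv').1 (hmB w hw).1
      ((SimpleGraph.compl_adj _ _ _).2 ⟨hne, fun h => ?_⟩)
      ((SimpleGraph.compl_adj _ _ _).2 ⟨hne' v hv, hvw⟩))
    exact col.valid h ((hmA v hv).2.trans (hmA v' hv').2.symm)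
  exact ⟨a, b, c, d, hab, hcd, hadj a (by simp) b (by simp) hab c (by simp),
    hadj a (by simp) b (by simp) hab d (by simp), hadj b (by simp) a (by simp) hab.symm c (by simp),
    hadj b (by simp) a (by simp) hab.symm d (by simp)⟩

/-! ### Bipartite graphs of order 18 -/

theorem exists_sparse_ten_of_parts {V : Type*} [DecidableEq V] {G : SimpleGraph V} {A B : Finset V}
    (hAB : Disjoint A B) (hA : A.card = 9) (hB : B.card = 9)
    (hAi : ∀ v ∈ A, ∀ w ∈ A, ¬ G.Adj v w) (hBi : ∀ v ∈ B, ∀ w ∈ B, ¬ G.Adj v w)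
    (hG : ∀ a b c d, a ≠ b → c ≠ d → G.Adj a c → G.Adj a d → G.Adj b c → G.Adj b d → False) :
    ∃ S : Finset V, S.card = 10 ∧ IsSparseSet G 1 S := by
  classical
  let e : Fin 9 ≃ A := (A.equivFinOfCardEq hA).symm
  let f : Fin 9 ≃ B := (B.equivFinOfCardEq hB).symm
  have he : Function.Injective fun i => (e i : V) := Subtype.val_injective.comp e.injective
  have hf : Function.Injective fun j => (f j : V) := Subtype.val_injective.comp f.injective
  have hlin : PartialLinearSpace.IsLinear fun i j => decide (G.Adj (e i) (f j)) := by
    intro i i' j j' hi hj h1 h2 h3 h4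
    exact hG _ _ _ _ (he.ne hi) (hf.ne hj) (of_decide_eq_true h1) (of_decide_eq_true h2)
      (of_decide_eq_true h3) (of_decide_eq_true h4)
  obtain ⟨X, Y, hXY, hY, hX⟩ := hlin.hasSparseTen
  simp only [decide_eq_true_eq] at hY hX
  have hsub : (Y.image fun i => (e i : V)) ⊆ A := image_subset_iff.2 fun i _ => (e i).2
  have hsub' : (X.image fun j => (f j : V)) ⊆ B := image_subset_iff.2 fun j _ => (f j).2
  have hcard : 10 ≤ #((Y.image fun i => (e i : V)) ∪ X.image fun j => (f j : V)) := by
    rw [card_union_of_disjoint (disjoint_of_subset_left hsub (disjoint_of_subset_right hsub' hAB)),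
      card_image_of_injective _ he, card_image_of_injective _ hf]
    omega
  obtain ⟨S, hS, hScard⟩ := exists_subset_card_eq hcard
  refine ⟨S, hScard, IsSparseSet.subset (isSparseSet_one_of_unique ?_) hS⟩
  intro v hv w hw w' hw' h h'
  rcases mem_union.1 hv with hv | hv
  · have hvA := hsub hv
    rcases mem_union.1 hw with hw | hw
    · exact absurd h (hAi v hvA w (hsub hw))
    rcases mem_union.1 hw' with hw' | hw'
    · exact absurd h' (hAi v hvA w' (hsub hw'))
    obtain ⟨i, hi, rfl⟩ := mem_image.1 hv
    obtain ⟨j, hj, rfl⟩ := mem_image.1 hw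
    obtain ⟨j', hj', rfl⟩ := mem_image.1 hw'
    rw [hY i hi j hj j' hj' h h']
  · have hvB := hsub' hv
    rcases mem_union.1 hw with hw | hw
    swap
    · exact absurd h (hBi v hvB w (hsub' hw))
    rcases mem_union.1 hw' with hw' | hw'
    swap
    · exact absurd h' (hBi v hvB w' (hsub' hw'))
    obtain ⟨j, hj, rfl⟩ := mem_image.1 hv
    obtain ⟨i, hi, rfl⟩ := mem_image.1 hw
    obtain ⟨i', hi', rfl⟩ := mem_image.1 hw'
    rw [hX j hj i hi i' hi' h.symm h'.symm]


theorem defectiveRamseyProperty_eighteen :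
    DefectiveRamseyProperty bipartiteGraphs.{u} 1 4 10 18 := by
  classical
  intro V _ G hV hG
  by_cases hC4 : ∃ a b c d, a ≠ b ∧ c ≠ d ∧ G.Adj a c ∧ G.Adj a d ∧ G.Adj b c ∧ G.Adj b d
  · obtain ⟨a, b, c, d, hab, hcd, hac, had, hbc, hbd⟩ := hC4
    refine Or.inl ⟨{a, b, c, d}, ?_, isDenseSet_one_of_fourCycle hac had hbc hbd⟩
    rw [card_insert_of_notMem, card_insert_of_notMem, card_pair hcd]
    · simp [hbc.ne, hbd.ne]
    · simp [hab, hac.ne, had.ne]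
  · right
    push Not at hC4
    obtain ⟨col⟩ := hG
    have hpart : ∀ t : Fin 2, ∀ v ∈ univ.filter (col · = t), ∀ w ∈ univ.filter (col · = t),
        ¬ G.Adj v w := by
      intro t v hv w hw h
      exact col.valid h ((mem_filter.1 hv).2.trans (mem_filter.1 hw).2.symm)
    have hbig : ∀ t : Fin 2, 10 ≤ #(univ.filter (col · = t)) →
        ∃ S : Finset V, S.card = 10 ∧ IsSparseSet G 1 S := by
      intro t ht
      obtain ⟨S, hS, hSc⟩ := exists_subset_card_eq ht
      exact ⟨S, hSc, (IsSparseSet.of_isIndep (hpart t)).subset hS⟩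
    have hsum : #(univ.filter (col · = 0)) + #(univ.filter (col · = 1)) = 18 := by
      have := card_eq_sum_card_fiberwise (s := (univ : Finset V)) (f := col) (t := univ) (by simp)
      rw [Fin.sum_univ_two, card_univ, hV] at this
      exact this.symm
    by_cases h0 : 10 ≤ #(univ.filter (col · = 0))
    · exact hbig 0 h0
    by_cases h1 : 10 ≤ #(univ.filter (col · = 1))
    · exact hbig 1 h1
    refine exists_sparse_ten_of_parts (A := univ.filter (col · = 0)) (B := univ.filter (col · = 1))
      ?_ (by omega) (by omega) (hpart 0) (hpart 1) fun a b c d hab hcd hac had hbc hbd =>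
        hC4 a b c d hab hcd hac had hbc hbd
    exact disjoint_filter.2 fun v _ h h' => absurd (h.symm.trans h') (by decide)

/-! ### The Möbius–Kantor graph -/

/-- The incidence matrix of the Möbius–Kantor configuration: line `i` consists of the points `i`,
`i + 1` and `i + 3` modulo `8`. -/
def mobiusKantorRow (i j : Fin 8) : Bool := j == i || j == i + 1 || j == i + 3

/-- The left-hand side bounds the size of a `1`-sparse set of the Möbius–Kantor graph whose lines
are those of `Y`: each of its points is off all lines of `Y` or is private to one of them, and
different points of the second kind are private to different lines. -/
theorem sparse_bound_mobiusKantor : ∀ Y : Finset (Fin 8),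
    #{j | ∀ i ∈ Y, mobiusKantorRow i j = false} +
      #{i ∈ Y | ∃ j, mobiusKantorRow i j = true ∧ ∀ i' ∈ Y, i' ≠ i → mobiusKantorRow i' j = false} +
      #Y ≤ 8 := by
  decide +kernel

theorem mobiusKantorRow_linear : ∀ i i' j j' : Fin 8, i ≠ i' → j ≠ j' →
    mobiusKantorRow i j = true → mobiusKantorRow i j' = true → mobiusKantorRow i' j = true →
    mobiusKantorRow i' j' = false := by
  decide +kernel

/-- The Möbius–Kantor graph, the incidence graph of the configuration: `Sum.inl` for the lines,
`Sum.inr` for the points. -/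
def mobiusKantorGraph : SimpleGraph (Fin 8 ⊕ Fin 8) where
  Adj
    | .inl i, .inr j => mobiusKantorRow i j = true
    | .inr j, .inl i => mobiusKantorRow i j = true
    | _, _ => False
  symm := ⟨by rintro (i | j) (i' | j') h <;> exact h⟩
  loopless := ⟨by rintro (i | j) h <;> exact h⟩

theorem card_le_eight_of_isSparseSet {S : Finset (Fin 8 ⊕ Fin 8)}
    (hS : IsSparseSet mobiusKantorGraph 1 S) : #S ≤ 8 := by
  classical
  set Y := S.toLeft with hY
  have hcover : #S.toRight ≤ #{j | ∀ i ∈ Y, mobiusKantorRow i j = false} +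
      #{i ∈ Y | ∃ j, mobiusKantorRow i j = true ∧
        ∀ i' ∈ Y, i' ≠ i → mobiusKantorRow i' j = false} := by
    rw [← card_filter_add_card_filter_not (s := S.toRight)
      (fun j => ∀ i ∈ Y, mobiusKantorRow i j = false)]
    refine add_le_add (card_le_card (filter_subset_filter _ (subset_univ _))) ?_
    have hline : ∀ j ∈ S.toRight.filter (fun j => ¬ ∀ i ∈ Y, mobiusKantorRow i j = false),
        ∃ i ∈ Y, mobiusKantorRow i j = true := by
      intro j hj
      have := (mem_filter.1 hj).2
      push Not at this
      obtain ⟨i, hi, hij⟩ := this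
      exact ⟨i, hi, by simpa using hij⟩
    choose! g hgY hg using hline
    refine card_le_card_of_injOn g (fun j hj => ?_) fun j hj j' hj' h => ?_
    · refine mem_filter.2 ⟨hgY j hj, j, hg j hj, fun i' hi' hne => ?_⟩
      by_contra hc
      have hjS : Sum.inr j ∈ S := mem_toRight.1 (mem_filter.1 hj).1
      exact hne (Sum.inl_injective (hS.eq_of_adj hjS (mem_toLeft.1 hi')
        (mem_toLeft.1 (hgY j hj)) (by simpa [mobiusKantorGraph] using hc)
        (by simpa [mobiusKantorGraph] using hg j hj)))
    · refine Sum.inr_injective (hS.eq_of_adj (mem_toLeft.1 (hgY j hj))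
        (mem_toRight.1 (mem_filter.1 hj).1) (mem_toRight.1 (mem_filter.1 hj').1)
        (by simpa [mobiusKantorGraph] using hg j hj) ?_)
      rw [h]
      simpa [mobiusKantorGraph] using hg j' hj'
  have := sparse_bound_mobiusKantor Y
  have : #Y + #S.toRight = #S := card_toLeft_add_card_toRight
  omega

theorem mobiusKantorGraph_not_fourCycle {a b c d : Fin 8 ⊕ Fin 8} (hab : a ≠ b) (hcd : c ≠ d)
    (hac : mobiusKantorGraph.Adj a c) (had : mobiusKantorGraph.Adj a d)
    (hbc : mobiusKantorGraph.Adj b c) (hbd : mobiusKantorGraph.Adj b d) : False := by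
  rcases a with a | a <;> rcases b with b | b <;> rcases c with c | c <;> rcases d with d | d <;>
    simp only [mobiusKantorGraph, ne_eq, Sum.inl.injEq, Sum.inr.injEq] at hab hcd hac had hbc hbd
  · simp [mobiusKantorRow_linear a b c d hab hcd hac had hbc] at hbd
  · simp [mobiusKantorRow_linear c d a b hcd hab hac hbc had] at hbd

/-- The Möbius–Kantor graph with an isolated vertex `none` added. -/
def mobiusKantorAddVertex : SimpleGraph (Option (Fin 8 ⊕ Fin 8)) :=
  mobiusKantorGraph.map Function.Embedding.some

theorem mobiusKantorAddVertex_adj {x y : Option (Fin 8 ⊕ Fin 8)} :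
    mobiusKantorAddVertex.Adj x y ↔ ∃ u v, mobiusKantorGraph.Adj u v ∧ some u = x ∧ some v = y :=
  SimpleGraph.map_adj _ _ _ _

theorem mobiusKantorAddVertex_adj_some {u v : Fin 8 ⊕ Fin 8} :
    mobiusKantorAddVertex.Adj (some u) (some v) ↔ mobiusKantorGraph.Adj u v :=
  SimpleGraph.map_adj_apply

theorem mobiusKantorAddVertex_isBipartite : mobiusKantorAddVertex.IsBipartite := by
  refine ⟨SimpleGraph.Coloring.mk (fun v => (v.elim 0 (Sum.elim 0 1) : Fin 2)) ?_⟩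
  intro v w hvw
  obtain ⟨x, y, hxy, rfl, rfl⟩ := mobiusKantorAddVertex_adj.1 hvw
  rcases x with x | x <;> rcases y with y | y <;> simp_all [mobiusKantorGraph]

/-! ### The Ramsey number -/

theorem not_defectiveRamseyProperty_of_le_seventeen {m : ℕ} (hm : m ≤ 17) :
    ¬ DefectiveRamseyProperty bipartiteGraphs.{u} 1 4 10 m := by
  classical
  intro h
  obtain ⟨f⟩ : Nonempty (ULift.{u} (Fin m) ↪ Option (Fin 8 ⊕ Fin 8)) :=
    Function.Embedding.nonempty_of_card_le (by simpa using hm)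
  have hbip : (mobiusKantorAddVertex.comap f).IsBipartite :=
    mobiusKantorAddVertex_isBipartite.of_hom (SimpleGraph.Hom.comap f _)
  rcases h _ (mobiusKantorAddVertex.comap f) (by simp) hbip with ⟨D, hDc, hD⟩ | ⟨S, hSc, hS⟩
  · obtain ⟨a, b, c, d, hab, hcd, hac, had, hbc, hbd⟩ := exists_fourCycle_of_isDenseSet hbip hD hDc
    obtain ⟨x, z, hxz, hx, hz⟩ := mobiusKantorAddVertex_adj.1 hac
    obtain ⟨y, w, hyw, hy, hw⟩ := mobiusKantorAddVertex_adj.1 hbd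
    have hab' := f.injective.ne hab
    have hcd' := f.injective.ne hcd
    simp only [SimpleGraph.comap_adj, ← hx, ← hy, ← hz, ← hw, mobiusKantorAddVertex_adj_some] at had hbc hab' hcd'
    exact mobiusKantorGraph_not_fourCycle (fun h => hab' (congrArg some h))
      (fun h => hcd' (congrArg some h)) hxz had hbc hyw
  · have hT : IsSparseSet mobiusKantorGraph 1 (S.map f).eraseNone := by
      refine isSparseSet_one_of_unique fun v hv w hw w' hw' h h' => ?_
      simp only [mem_eraseNone, mem_map] at hv hw hw'
      obtain ⟨v₀, hv₀, hv⟩ := hv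
      obtain ⟨w₀, hw₀, hw⟩ := hw
      obtain ⟨w₁, hw₁, hw'⟩ := hw'
      have := hS.eq_of_adj hv₀ hw₀ hw₁
        (by simpa [hv, hw, mobiusKantorAddVertex_adj_some] using h)
        (by simpa [hv, hw', mobiusKantorAddVertex_adj_some] using h')
      rw [this, hw'] at hw
      exact (Option.some_injective _ hw).symm
    have h8 := card_le_eight_of_isSparseSet hT
    have h9 : #(S.map f) ≤ #(S.map f).eraseNone + 1 := by
      rw [← card_insertNone]
      exact card_le_card (by intro x hx; rcases x with _ | x <;> simp_all)
    rw [card_map, hSc] at h9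
    omega

theorem mainTheorem4 :
    IsDefectiveRamseyNumber bipartiteGraphs.{u} 1 4 10 18 ∧
      ¬ IsDefectiveRamseyNumber bipartiteGraphs.{u} 1 4 10 (2 * 10 - 1) := by
  have h18 : IsDefectiveRamseyNumber bipartiteGraphs.{u} 1 4 10 18 := by
    refine ⟨defectiveRamseyProperty_eighteen, fun m hm => ?_⟩
    by_contra! hlt
    exact not_defectiveRamseyProperty_of_le_seventeen (Nat.lt_succ_iff.1 hlt) hm
  exact ⟨h18, fun h19 => absurd (h18.unique h19) (by decide)⟩
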